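/- Let $G$ be a Polish group. A set $U\subseteq G$ is universally measurable if it is measurable with respect to the completion of every Borel probability measure on $G$. A set $X\subseteq G$ is Haar null if there are a universally measurable set $U\supseteq X$ and a Borel probability measure $\mu$ on $G$ with $\mu(gUh)=0$ for all $g,h\in G$; it is naively Haar null if there is a Borel probability measure $\mu$ on $G$ such that $gXh$ is $\mu$-null (for the completion of $\mu$) for all $g,h\in G$. **Theorem.** Let $G$ be an abelian Polish group that is not locally compact. Then there is a set $X\subseteq G$ that is naively Haar null but not Haar null. Moreover, $X$ can be chosen so that there is an atomless Borel probability measure $\nu$ on $G$ with compact support $C$ such that $|gC\cap X|\le 1$ for every $g\in G$ and $\nu(gXh)=0$ for all $g,h\in G$. -/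

import Mathlib

open MeasureTheory

/-- A set is universally measurable if it is measurable with respect to (the completion of)
every Borel probability measure. -/
def IsUniversallyMeasurable {G : Type*} [MeasurableSpace G] (U : Set G) : Prop :=
  ∀ μ : Measure G, IsProbabilityMeasure μ → NullMeasurableSet U μ

/-- The two-sided translate `g X h`. -/
def twoSidedTranslate {G : Type*} [Mul G] (g : G) (X : Set G) (h : G) : Set G :=
  (fun x => g * x * h) '' X

/-- `X` is Haar null if it has a universally measurable hull `U` and a Borel probability measure
`μ` vanishing on all two-sided translates of `U`. -/
def IsHaarNull {G : Type*} [Group G] [MeasurableSpace G] (X : Set G) : Prop :=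
  ∃ U : Set G, IsUniversallyMeasurable U ∧ X ⊆ U ∧
    ∃ μ : Measure G, IsProbabilityMeasure μ ∧ ∀ g h : G, μ (twoSidedTranslate g U h) = 0

/-- `X` is naively Haar null if some Borel probability measure vanishes on all two-sided
translates of `X` itself. A Mathlib measure is defined on all sets as the induced outer measure,
so `μ A = 0` says that `A` is null for the completion of `μ`. -/
def IsNaivelyHaarNull {G : Type*} [Group G] [MeasurableSpace G] (X : Set G) : Prop :=
  ∃ μ : Measure G, IsProbabilityMeasure μ ∧ ∀ g h : G, μ (twoSidedTranslate g X h) = 0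

open Set Filter Topology Cardinal
open scoped Pointwise ENNReal

section CantorSets

variable {G : Type*} [CommGroup G]

/-! Let `ν` be atomless on a Cantor set, with support `C`, and put `D = C / C`. Transfinite
recursion picks a point in every Borel set not covered by fewer than continuum many translates of
`D`, keeping all mutual quotients outside `D`. Each translate of `C` then contains at most one
chosen point, so `ν` kills every translate of `X`. Conversely,
`exists_measurableSet_disjoint_not_covered` shows that a universally measurable set with null
translates misses one of these Borel sets, hence misses a point of `X`. -/

theorem IsCompact.div_self_of_group [TopologicalSpace G] [IsTopologicalGroup G] {K : Set G}
    (hK : IsCompact K) : IsCompact (K / K) := by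
  rw [div_eq_mul_inv]
  exact hK.mul hK.inv

/-- In a topological group that is not locally compact, every nonempty open set contains two points
whose quotient avoids a given compact set. -/
theorem exists_div_notMem_of_isCompact [TopologicalSpace G] [IsTopologicalGroup G]
    (hG : ¬ LocallyCompactSpace G) {Q : Set G} (hQ : IsCompact Q) {A : Set G} (hA : IsOpen A)
    (hne : A.Nonempty) : ∃ a ∈ A, ∃ b ∈ A, a / b ∉ Q := by
  obtain ⟨b, hb⟩ := hne
  by_contra! h
  refine hG (hQ.locallyCompactSpace_of_mem_nhds_of_group (x := 1) ?_)
  have : (fun x => x * b) ⁻¹' A ∈ 𝓝 (1 : G) :=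
    (hA.preimage (continuous_mul_const b)).mem_nhds (by simpa using hb)
  filter_upwards [this] with x hx
  simpa using h _ hx b hb

theorem exists_isOpen_splitting [MetricSpace G] [IsTopologicalGroup G]
    (hG : ¬ LocallyCompactSpace G) {Q : Set G} (hQ : IsCompact Q) {A : Set G} (hA : IsOpen A)
    (hne : A.Nonempty) {ε : ℝ≥0∞} (hε : 0 < ε) :
    ∃ C : Bool → Set G, (∀ i, (IsOpen (C i) ∧ (C i).Nonempty) ∧ closure (C i) ⊆ A ∧
      Metric.ediam (C i) ≤ ε) ∧ ∀ x ∈ C true, ∀ y ∈ C false, x / y ∉ Q := by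
  obtain ⟨a, ha, b, hb, hab⟩ := exists_div_notMem_of_isCompact hG hQ hA hne
  have small : ∀ c ∈ A, ∀ U ∈ 𝓝 c, ∃ V : Set G, (IsOpen V ∧ V.Nonempty) ∧ closure V ⊆ A ∧
      Metric.ediam V ≤ ε ∧ V ⊆ U := by
    intro c hc U hU
    have hN : U ∩ A ∩ Metric.eball c (ε / 2) ∈ 𝓝 c :=
      inter_mem (inter_mem hU (hA.mem_nhds hc))
        (Metric.eball_mem_nhds c (ENNReal.half_pos hε.ne'))
    obtain ⟨K, ⟨hK, hKc⟩, hKN⟩ := (closed_nhds_basis c).mem_iff.1 hN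
    refine ⟨interior K, ⟨isOpen_interior, c, mem_interior_iff_mem_nhds.2 hK⟩, ?_, ?_, ?_⟩
    · exact (closure_minimal interior_subset hKc).trans fun x hx => (hKN hx).1.2
    · refine (Metric.ediam_mono (interior_subset.trans fun x hx => (hKN hx).2)).trans
        (Metric.ediam_eball_le.trans ?_)
      rw [ENNReal.mul_div_cancel (by simp) (by simp)]
    · exact interior_subset.trans fun x hx => (hKN hx).1.1
  have hnear : ∀ᶠ p : G × G in 𝓝 a ×ˢ 𝓝 b, p.1 / p.2 ∉ Q := by
    rw [← nhds_prod_eq]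
    exact (hQ.isClosed.isOpen_compl.preimage (continuous_fst.div' continuous_snd)).mem_nhds hab
  obtain ⟨U, hU, W, hW, hUW⟩ := Filter.mem_prod_iff.1 hnear
  obtain ⟨V₁, h₁, h₁', h₁'', hV₁⟩ := small a ha U hU
  obtain ⟨V₀, h₀, h₀', h₀'', hV₀⟩ := small b hb W hW
  refine ⟨fun i => bif i then V₁ else V₀, ?_, fun x hx y hy => ?_⟩
  · rintro (_ | _)
    exacts [⟨h₀, h₀', h₀''⟩, ⟨h₁, h₁', h₁''⟩]
  · exact @hUW (x, y) ⟨hV₁ hx, hV₀ hy⟩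

open CantorScheme in
theorem exists_continuous_cantor_div_notMem_of_metric [MetricSpace G] [CompleteSpace G]
    [IsTopologicalGroup G] (hG : ¬ LocallyCompactSpace G) {Q : Set G} (hQ : IsCompact Q) :
    ∃ φ : (ℕ → Bool) → G, Continuous φ ∧ ∀ x y, x ≠ y → φ x / φ y ∉ Q := by
  -- Splitting controls only quotients of the `true` piece by the `false` one; symmetrizing `Q`
  -- covers both orders.
  have hQ' : IsCompact (Q ∪ Q⁻¹) := hQ.union hQ.inv
  obtain ⟨u, -, upos', hu⟩ := exists_seq_strictAnti_tendsto' (zero_lt_one' ℝ≥0∞)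
  have upos := fun n => (upos' n).1
  let P := {A : Set G // IsOpen A ∧ A.Nonempty}
  choose C hC hCQ using fun (A : P) (n : ℕ) =>
    exists_isOpen_splitting hG hQ' A.2.1 A.2.2 (upos n)
  let T : List Bool → P := fun l =>
    List.rec ⟨univ, isOpen_univ, ⟨1, mem_univ _⟩⟩
      (fun a l A => ⟨C A (l.length + 1) a, (hC A (l.length + 1) a).1⟩) l
  let D : List Bool → Set G := fun l => (T l).1
  have hD : ∀ a l, D (a :: l) = C (T l) (l.length + 1) a := fun _ _ => rfl
  have hanti : ClosureAntitone D := fun l a => by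
    rw [hD]
    exact (hC _ _ _).2.1
  have hdiam : VanishingDiam D := by
    intro x
    -- The root `univ` has no diameter bound, so level 0 is skipped.
    rw [← tendsto_add_atTop_iff_nat 1]
    refine tendsto_of_tendsto_of_tendsto_of_le_of_le tendsto_const_nhds
      ((tendsto_add_atTop_iff_nat 1).2 hu) (fun _ => zero_le) fun n => ?_
    simp only [PiNat.res_succ, hD]
    refine (hC _ _ _).2.2.trans_eq ?_
    rw [PiNat.res_length]
  have hdom : ∀ x, x ∈ (inducedMap D).1 := fun x => by
    rw [hanti.map_of_vanishingDiam hdiam fun l => (T l).2.2]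
    trivial
  let φ : (ℕ → Bool) → G := fun x => (inducedMap D).2 ⟨x, hdom x⟩
  have hφ : ∀ x n, φ x ∈ D (PiNat.res x n) := fun x n => map_mem ⟨x, hdom x⟩ n
  refine ⟨φ, hdiam.map_continuous.comp (continuous_id.subtype_mk hdom), ?_⟩
  have key : ∀ x y n, PiNat.res x n = PiNat.res y n → x n = true → y n = false →
      φ x / φ y ∉ Q ∪ Q⁻¹ := by
    intro x y n hn hx hy
    have h₁ := hφ x (n + 1)
    have h₀ := hφ y (n + 1)
    rw [PiNat.res_succ, hD, hx] at h₁
    rw [PiNat.res_succ, hD, hy, ← hn] at h₀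
    exact hCQ _ _ _ h₁ _ h₀
  intro x y hxy
  have hres : PiNat.res x (PiNat.firstDiff x y) = PiNat.res y (PiNat.firstDiff x y) :=
    PiNat.res_eq_res.2 fun _ hm => PiNat.apply_eq_of_lt_firstDiff hm
  have hne := PiNat.apply_firstDiff_ne hxy
  cases hx : x (PiNat.firstDiff x y)
  · have hy : y (PiNat.firstDiff x y) = true := by
      rw [hx] at hne
      simpa using hne.symm
    intro h
    refine key y x _ hres.symm hy hx (Or.inr ?_)
    rwa [Set.mem_inv, inv_div]
  · have hy : y (PiNat.firstDiff x y) = false := by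
      rw [hx] at hne
      simpa using hne.symm
    exact fun h => key x y _ hres hx hy (Or.inl h)

/-- A non-locally compact abelian Polish group contains, for every compact set `Q`, a continuous
image of the Cantor space in which the quotient of any two distinct points avoids `Q`. -/
theorem exists_continuous_cantor_div_notMem [TopologicalSpace G] [IsTopologicalGroup G]
    [PolishSpace G] (hG : ¬ LocallyCompactSpace G) {Q : Set G} (hQ : IsCompact Q) :
    ∃ φ : (ℕ → Bool) → G, Continuous φ ∧ ∀ x y, x ≠ y → φ x / φ y ∉ Q := by
  let := TopologicalSpace.upgradeIsCompletelyMetrizable G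
  exact exists_continuous_cantor_div_notMem_of_metric hG hQ

end CantorSets

section Cardinality

/-- Transfinite choice of representatives pairwise unrelated by a symmetric relation. -/
theorem exists_choice_pairwise_not {ι G : Type*} {κ : Cardinal} (hι : #ι ≤ κ) (B : ι → Set G)
    (R : G → G → Prop) (hR : ∀ x y, R x y → R y x)
    (hB : ∀ i, ∀ {J : Set ι} (f : J → G), #J < κ → ∃ x ∈ B i, ∀ j, ¬ R (f j) x) :
    ∃ f : ι → G, (∀ i, f i ∈ B i) ∧ Pairwise fun i j => ¬ R (f i) (f j) := by
  obtain ⟨r, hr, hord⟩ := Cardinal.exists_ord_eq ι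
  -- The order type of `r` is an initial ordinal, so proper initial segments have smaller
  -- cardinality.
  have hcard : ∀ i, #{j | r j i} < κ := fun i =>
    (Cardinal.card_typein_lt i hord).trans_le hι
  choose next hnext hnext' using hB
  let f : ι → G := hr.wf.fix fun i F => next i (J := {j | r j i}) (fun j => F j.1 j.2) (hcard i)
  have hf : ∀ i, f i = next i (J := {j | r j i}) (fun j => f j.1) (hcard i) := fun i =>
    hr.wf.fix_eq _ i
  have hlt : ∀ i j, r j i → ¬ R (f j) (f i) := fun i j hji => by
    rw [hf i]
    exact hnext' i (fun j : {j | r j i} => f j.1) (hcard i) ⟨j, hji⟩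
  refine ⟨f, fun i => ?_, fun i j hij => ?_⟩
  · rw [hf i]
    exact hnext i _ _
  · rcases trichotomous_of r i j with h | h | h
    · exact hlt j i h
    · exact absurd h hij
    · exact fun hRij => hlt i j h (hR _ _ hRij)

theorem mk_measurableSet_le_continuum (G : Type*) [MeasurableSpace G]
    [MeasurableSpace.CountablyGenerated G] : #{B : Set G | MeasurableSet B} ≤ 𝔠 := by
  obtain ⟨b, hb, h⟩ := MeasurableSpace.CountablyGenerated.isCountablyGenerated (α := G)
  subst h
  exact MeasurableSpace.cardinal_measurableSet_le_continuum
    (hb.le_aleph0.trans aleph0_le_continuum)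

theorem mk_eq_continuum_of_measurableSet {α : Type*} [MeasurableSpace α] [StandardBorelSpace α]
    {T : Set α} (hT : MeasurableSet T) (hc : ¬ T.Countable) : #T = 𝔠 := by
  have := hT.standardBorel
  have e := PolishSpace.measurableEquivNatBoolOfNotCountable (α := T) hc
  have := Cardinal.mk_congr_lift e.toEquiv
  simpa using this

/-- The Cantor space carries an atomless probability measure. -/
theorem exists_isProbabilityMeasure_nullSingleton_cantor :
    ∃ m : Measure (ℕ → Bool), IsProbabilityMeasure m ∧ NullSingletonClass m := by
  have h : ¬ Countable unitInterval := fun h => by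
    have := Set.Countable.measure_zero (Set.countable_univ (α := unitInterval)) volume
    simp at this
  let e := PolishSpace.measurableEquivNatBoolOfNotCountable h
  refine ⟨volume.map e, Measure.isProbabilityMeasure_map e.measurable.aemeasurable, ⟨fun x => ?_⟩⟩
  rw [e.map_apply]
  exact (Set.subsingleton_singleton.preimage e.injective).measure_zero _

end Cardinality

section NotHaarNull

universe u

variable {G : Type u} [CommGroup G] [TopologicalSpace G] [IsTopologicalGroup G] [PolishSpace G]
  [MeasurableSpace G] [BorelSpace G]

/-- If all translates of the universally measurable set `U` are null, then `U` misses a Borel set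
that cannot be covered by fewer than continuum many translates of the compact set `D`. -/
theorem exists_measurableSet_disjoint_not_covered (hG : ¬ LocallyCompactSpace G) {D : Set G}
    (hD : IsCompact D) {U : Set G} (hU : IsUniversallyMeasurable U) {μ : Measure G}
    [IsProbabilityMeasure μ] (hμ : ∀ g h : G, μ (twoSidedTranslate g U h) = 0) :
    ∃ B : Set G, MeasurableSet B ∧ Disjoint B U ∧
      ∀ {J : Type u} (f : J → G), #J < 𝔠 → ∃ x ∈ B, ∀ j, f j / x ∉ D := by
  obtain ⟨M, -, hM, hMpos⟩ : ∃ M ⊆ (univ : Set G), IsCompact M ∧ 0 < μ M :=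
    MeasurableSet.univ.exists_lt_isCompact (by simp)
  -- If one `f j` serves both `x * φ c` and `x' * φ c'` with `x, x' ∈ M`, then `φ c / φ c'` lies in
  -- `(D / D) * (M / M)`; avoiding this set forces `c = c'`.
  obtain ⟨φ, hφ, hφQ⟩ := exists_continuous_cantor_div_notMem hG (hD.div_self_of_group.mul hM.div_self_of_group)
  obtain ⟨m, hm, hm'⟩ := exists_isProbabilityMeasure_nullSingleton_cantor
  let μ' := ProbabilityTheory.cond μ M
  have hμ' : IsProbabilityMeasure μ' := ProbabilityTheory.cond_isProbabilityMeasure hMpos.ne'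
  have hac : μ' ≪ μ := ProbabilityTheory.cond_absolutelyContinuous
  have hM' : ∀ᵐ x ∂μ', x ∈ M := ProbabilityTheory.ae_cond_mem hM.measurableSet
  have hψ : Measurable fun p : (ℕ → Bool) × G => p.2 * φ p.1 :=
    measurable_snd.mul (hφ.measurable.comp measurable_fst)
  let lam : Measure G := (m.prod μ').map fun p => p.2 * φ p.1
  have hlam : IsProbabilityMeasure lam := Measure.isProbabilityMeasure_map hψ.aemeasurable
  have hnull : ∀ A : Set G, MeasurableSet A →
      (lam A = 0 ↔ ∀ᵐ c ∂m, μ' {x | x * φ c ∈ A} = 0) := fun A hA => by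
    rw [Measure.map_apply hψ hA, Measure.measure_prod_null (hψ hA)]
    rfl
  have hUnull : lam U = 0 := by
    obtain ⟨A, hAU, hA, hAe⟩ := (hU lam hlam).exists_measurable_subset_ae_eq
    rw [← measure_congr hAe, hnull A hA]
    refine Eventually.of_forall fun c => hac (measure_mono_null ?_ (hμ 1 (φ c)⁻¹))
    exact fun x hx => ⟨x * φ c, hAU hx, by simp⟩
  have hVm : MeasurableSet (toMeasurable lam U) := measurableSet_toMeasurable _ _
  -- The Borel hull may exceed `U`, so its translates need not be null; Fubini still makes almost
  -- every section null.
  have hV : ∀ᵐ c ∂m, μ' {x | x * φ c ∈ toMeasurable lam U} = 0 := by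
    rw [← hnull _ hVm, measure_toMeasurable, hUnull]
  obtain ⟨T, hT, hTm, hT1⟩ : ∃ T ⊆ {c | μ' {x | x * φ c ∈ toMeasurable lam U} = 0},
      MeasurableSet T ∧ ∀ᵐ c ∂m, c ∈ T := by
    obtain ⟨T, hT1, hTm, hT⟩ := Filter.Eventually.exists_measurable_mem hV
    exact ⟨T, hT, hTm, hT1⟩
  have hTcard : #T = 𝔠 := by
    refine mk_eq_continuum_of_measurableSet hTm fun hc => ?_
    have h0 : m T = 0 := hc.measure_zero m
    have h1 : m Tᶜ = 0 := hT1
    have := (measure_union_le (μ := m) T Tᶜ)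
    simp [h0, h1] at this
  refine ⟨(toMeasurable lam U)ᶜ, hVm.compl,
    disjoint_compl_left.mono_right (subset_toMeasurable _ _), fun {J} f hJ => ?_⟩
  by_contra! hcov
  have hpt : ∀ c : T, ∃ x ∈ M, x * φ c ∈ (toMeasurable lam U)ᶜ := fun c => by
    have h1 : ∀ᵐ x ∂μ', ¬ x * φ c ∈ toMeasurable lam U := by
      rw [ae_iff]
      simpa using hT c.2
    exact (hM'.and h1).exists
  choose x hxM hx using hpt
  choose j hj using fun c : T => hcov _ (hx c)
  have hinj : Function.Injective j := fun c c' hcc => by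
    by_contra hne
    refine hφQ c c' (fun h => hne (Subtype.ext h)) (Set.mem_mul.2
      ⟨_, Set.div_mem_div (hj c') (hj c), _, Set.div_mem_div (hxM c') (hxM c), ?_⟩)
    rw [hcc, div_div_div_cancel_left, mul_div_mul_comm, mul_right_comm, div_mul_div_cancel,
      div_self', one_mul]
  have hle := Cardinal.mk_le_of_injective
    (Equiv.ulift.symm.injective.comp (hinj.comp Equiv.ulift.{u}.injective) :
      Function.Injective (fun c : ULift.{u} T => ULift.up.{0} (j c.down)))
  rw [Cardinal.mk_uLift, Cardinal.mk_uLift, hTcard, Cardinal.lift_continuum,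
    Cardinal.lift_uzero] at hle
  exact hle.not_gt hJ

end NotHaarNull

theorem theorem4p1 {G : Type*} [CommGroup G] [TopologicalSpace G] [IsTopologicalGroup G]
    [PolishSpace G] [MeasurableSpace G] [BorelSpace G] (hG : ¬ LocallyCompactSpace G) :
    ∃ X : Set G, IsNaivelyHaarNull X ∧ ¬ IsHaarNull X ∧
      ∃ ν : Measure G, IsProbabilityMeasure ν ∧ (∀ x : G, ν {x} = 0) ∧ IsCompact ν.support ∧
        (∀ g : G, (((fun x => g * x) '' ν.support) ∩ X).Subsingleton) ∧
        ∀ g h : G, ν (twoSidedTranslate g X h) = 0 := by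
  -- Avoiding `{1}` amounts to injectivity of `φ`.
  obtain ⟨φ, hφ, hφ1⟩ := exists_continuous_cantor_div_notMem hG (isCompact_singleton (x := (1 : G)))
  have hinj : Function.Injective φ := fun x y h => by
    by_contra hne
    exact hφ1 x y hne (by simp [h])
  obtain ⟨m, hm, hm'⟩ := exists_isProbabilityMeasure_nullSingleton_cantor
  let ν : Measure G := m.map φ
  have hν : IsProbabilityMeasure ν := Measure.isProbabilityMeasure_map hφ.measurable.aemeasurable
  have hatom : ∀ x : G, ν {x} = 0 := fun x => by
    rw [Measure.map_apply hφ.measurable (measurableSet_singleton x)]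
    exact (Set.subsingleton_singleton.preimage hinj).measure_zero _
  have hcpt : IsCompact ν.support := by
    refine (isCompact_range hφ).of_isClosed_subset Measure.isClosed_support
      (Measure.support_subset_of_isClosed (isCompact_range hφ).isClosed ?_)
    rw [mem_ae_iff, Measure.map_apply hφ.measurable
      (isCompact_range hφ).isClosed.measurableSet.compl]
    simp
  let D : Set G := ν.support / ν.support
  let ι := {B : Set G // MeasurableSet B ∧
    ∀ {J : Type _} (f : J → G), #J < 𝔠 → ∃ x ∈ B, ∀ j, f j / x ∉ D}
  have hι : #ι ≤ 𝔠 :=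
    (Cardinal.mk_subtype_mono fun _ h => h.1).trans (mk_measurableSet_le_continuum G)
  obtain ⟨f, hfB, hf⟩ := exists_choice_pairwise_not hι (fun B => B.1) (fun x y => x / y ∈ D)
    (by
      rintro x y ⟨a, ha, b, hb, hab⟩
      exact ⟨b, hb, a, ha, by simpa using congrArg (·⁻¹) hab⟩)
    (fun B _ f hJ => B.2.2 f hJ)
  have hsub : ∀ g : G, (((fun x => g * x) '' ν.support) ∩ range f).Subsingleton := by
    rintro g _ ⟨⟨a, ha, hai⟩, i, rfl⟩ _ ⟨⟨b, hb, hbj⟩, j, rfl⟩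
    by_contra hne
    refine hf (fun h => hne (congrArg f h)) ⟨a, ha, b, hb, ?_⟩
    simp only at hai hbj ⊢
    rw [← hai, ← hbj, mul_div_mul_left_eq_div]
  have hnull : ∀ g h : G, ν (twoSidedTranslate g (range f) h) = 0 := fun g h => by
    refine measure_mono_null (t := (twoSidedTranslate g (range f) h ∩ ν.support) ∪ ν.supportᶜ)
      (fun x hx => ?_) (measure_union_null ?_ Measure.measure_compl_support)
    · by_cases hxs : x ∈ ν.support
      exacts [Or.inl ⟨hx, hxs⟩, Or.inr hxs]
    · have hs : (twoSidedTranslate g (range f) h ∩ ν.support).Subsingleton := by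
        rintro _ ⟨⟨x, hx, rfl⟩, hxs⟩ _ ⟨⟨y, hy, rfl⟩, hys⟩
        -- By commutativity, a two-sided translate is the one-sided translate by `g * h`.
        have hcancel : ∀ z : G, (g * h)⁻¹ * (g * z * h) = z := fun z => by
          rw [mul_right_comm, inv_mul_cancel_left]
        have := hsub (g * h)⁻¹ ⟨⟨_, hxs, hcancel x⟩, hx⟩ ⟨⟨_, hys, hcancel y⟩, hy⟩
        simp only [this]
      rcases hs.eq_empty_or_singleton with h0 | ⟨x, h0⟩
      · rw [h0, measure_empty]
      · rw [h0, hatom]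
  refine ⟨range f, ⟨ν, hν, hnull⟩, ?_, ν, hν, hatom, hcpt, hsub, hnull⟩
  rintro ⟨U, hU, hXU, μ, hμ, hμU⟩
  obtain ⟨B, hB, hBU, hcov⟩ :=
    exists_measurableSet_disjoint_not_covered hG hcpt.div_self_of_group hU hμU
  exact hBU.notMem_of_mem_left (hfB ⟨B, hB, hcov⟩) (hXU (mem_range_self _))
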